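/- Let $n,d\in\mathbb{N}$, let $V\subset\mathbb{R}^n$ be open, and let $A\colon V\to\mathbb{R}^{d\times d}_{+}$ be a locally Lipschitz continuous function with values in the symmetric positive definite $d\times d$ matrices. For $r\in\mathbb{R}$ and a symmetric positive definite matrix $M=QDQ^{T}$ ($Q$ orthogonal, $D$ diagonal) put $M^{r}=QD^{r}Q^{T}$ and $\log M=Q(\log D)Q^{T}$. Denote by $\mathcal{D}_i$ the $i$-th partial derivative and, for $\lambda\in\mathbb{R}$, let $\mathcal{D}^{\lambda}A=(\mathcal{D}^{\lambda}_iA)_{i=1}^n$, where $$\mathcal{D}^{\lambda}_iA=\lambda^{-1}\,\mathcal{D}_i(A^{\lambda})\ \text{ if }\lambda\neq0,\qquad \mathcal{D}^{0}_iA=\mathcal{D}_i(\log A).$$ Let $\langle X,Y\rangle$ be the Euclidean inner product (the sum of the products of corresponding entries) of $d\times d$ matrices or of $n\times d\times d$ tensors, and $|X|=\sqrt{\langle X,X\rangle}$. Let $p,q\ge0$ and $\alpha,\beta,\gamma,\delta\in\mathbb{R}$. Then all functions $A^{\lambda}$, $\lambda\in\mathbb{R}$, and $\log A$ are locally Lipschitz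 on $V$ and hence differentiable almost everywhere, so that $\mathcal{D}^{\lambda}A$ is defined almost everywhere in $V$, and almost everywhere in $V$ the following hold: $$\langle\mathcal{D}_i^{\alpha}A,A^{\beta}\rangle=\langle\mathcal{D}_i^{\alpha+\beta}A,I\rangle\qquad(i=1,\dots,n),$$ where $I$ is the identity matrix; the tensor inner products $\langle\mathcal{D}^{\alpha}A,\mathcal{D}^{\beta}A\rangle$ and $\langle\mathcal{D}^{\gamma}A,\mathcal{D}^{\delta}A\rangle$ are nonnegative; and $$\langle\mathcal{D}^{\alpha}A,\mathcal{D}^{\beta}A\rangle^{p}\,\langle\mathcal{D}^{\gamma}A,\mathcal{D}^{\delta}A\rangle^{q}\ \ge\ \Big|\mathcal{D}^{\frac{(\alpha+\beta)p+(\gamma+\delta)q}{2p+2q}}A\Big|^{2p+2q}.$$ Here $0^0=1$, and for $p=q=0$ both sides are read as $1$. -/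

import Mathlib

open MeasureTheory

noncomputable section

/-- The real power `M ^ r` of a symmetric positive definite matrix: with `M = Q D Qᵀ` a spectral
decomposition, this is `Q D ^ r Qᵀ` (functional calculus of `t ↦ t ^ r`). -/
def matPow {d : ℕ} (M : Matrix (Fin d) (Fin d) ℝ) (r : ℝ) : Matrix (Fin d) (Fin d) ℝ :=
  cfc (fun t : ℝ => t ^ r) M

/-- The logarithm `Q (log D) Qᵀ` of a symmetric positive definite matrix `M = Q D Qᵀ`. -/
def matLog {d : ℕ} (M : Matrix (Fin d) (Fin d) ℝ) : Matrix (Fin d) (Fin d) ℝ :=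
  cfc Real.log M

/-- Local Lipschitz continuity on `V` of a matrix valued function, entry by entry. -/
def LocLipOn {n d : ℕ} (V : Set (EuclideanSpace ℝ (Fin n)))
    (F : EuclideanSpace ℝ (Fin n) → Matrix (Fin d) (Fin d) ℝ) : Prop :=
  ∀ j k, LocallyLipschitzOn V (fun x => F x j k)

/-- Classical (Fréchet) differentiability at `x` of a matrix valued function, entry by entry. -/
def MatDifferentiableAt {n d : ℕ}
    (F : EuclideanSpace ℝ (Fin n) → Matrix (Fin d) (Fin d) ℝ) (x : EuclideanSpace ℝ (Fin n)) :
    Prop :=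
  ∀ j k, DifferentiableAt ℝ (fun y => F y j k) x

/-- The `i`-th partial derivative of a matrix valued function at `x`. -/
def partialD {n d : ℕ} (i : Fin n)
    (F : EuclideanSpace ℝ (Fin n) → Matrix (Fin d) (Fin d) ℝ) (x : EuclideanSpace ℝ (Fin n)) :
    Matrix (Fin d) (Fin d) ℝ :=
  Matrix.of fun j k => lineDeriv ℝ (fun y => F y j k) x (EuclideanSpace.single i 1)

/-- The nonlinear operator `𝒟ᵢ^r A`, equal to `r⁻¹ 𝒟ᵢ (A ^ r)` if `r ≠ 0` and to `𝒟ᵢ (log A)` if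
`r = 0`. For fixed `r`, `A` and `x`, the family over `i` is the tensor `𝒟^r A (x)`. -/
def powD {n d : ℕ} (r : ℝ) (A : EuclideanSpace ℝ (Fin n) → Matrix (Fin d) (Fin d) ℝ)
    (x : EuclideanSpace ℝ (Fin n)) (i : Fin n) : Matrix (Fin d) (Fin d) ℝ :=
  if r = 0 then partialD i (fun y => matLog (A y)) x
  else r⁻¹ • partialD i (fun y => matPow (A y) r) x

/-- The Euclidean (Frobenius) inner product on `d × d` matrices. -/
def innerMat {d : ℕ} (X Y : Matrix (Fin d) (Fin d) ℝ) : ℝ :=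
  ∑ j, ∑ k, X j k * Y j k

/-- The Euclidean inner product on `n × d × d` tensors. -/
def innerTensor {n d : ℕ} (X Y : Fin n → Matrix (Fin d) (Fin d) ℝ) : ℝ :=
  ∑ i, ∑ j, ∑ k, X i j k * Y i j k

/-- The Euclidean norm on `n × d × d` tensors. -/
def normTensor {n d : ℕ} (X : Fin n → Matrix (Fin d) (Fin d) ℝ) : ℝ :=
  Real.sqrt (innerTensor X X)

end

/-! ### Perturbation of the functional calculus of a symmetric matrix. -/

section MatrixFunctionalCalculus

open Matrix Filter Topology
open scoped Matrix.Norms.L2Operator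

variable {d : ℕ}

/-! Fix a point `x` where `A` is differentiable, and let `U` and `a_j` be the eigenbasis and
eigenvalues of `A x`. By the Daleckii-Krein formula (`star_mul_partialD_cfc_mul_apply`),
differentiating `f(A)` multiplies the `(j, k)` entry of `U* (𝒟ᵢ A) U` by the divided difference
`f[a_j, a_k]`. For `f = r⁻¹ t ^ r`, or `log` when `r = 0`, this factor is `L_r(a_j, a_k)`, the mean
of `v ^ (r - 1)` over the segment (`segmentPowMean`). Hence all tensors `𝒟^r A` share the entries of
`U* (𝒟ᵢ A) U` and differ only in positive multipliers.

The identity involves only diagonal entries, where `L_r(a, a) = a ^ (r - 1)`. Inner products become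
sums of `L_r L_s` with common nonnegative weights. Hölder for the integral makes `r ↦ L_r`
log-convex, and Hölder for the sum, with exponents determined by `s = p / (p + q)`, gives the
inequality.

Eigenvectors need not vary differentiably, so both the Lipschitz bound and the derivative come from
the factorisation `star_eigenvectorUnitary_mul_cfc_sub_cfc`, which uses the eigenbasis of one fixed
matrix only. -/

lemma Matrix.IsHermitian.cfc_eq_mul_diagonal_mul {M : Matrix (Fin d) (Fin d) ℝ}
    (hM : M.IsHermitian) (f : ℝ → ℝ) :
    cfc f M = (hM.eigenvectorUnitary : Matrix (Fin d) (Fin d) ℝ) *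
      diagonal (fun j => f (hM.eigenvalues j)) *
      star (hM.eigenvectorUnitary : Matrix (Fin d) (Fin d) ℝ) := by
  rw [hM.cfc_eq, Matrix.IsHermitian.cfc, Unitary.conjStarAlgAut_apply]
  rfl

/-- Unitary conjugation preserves the operator norm, and a diagonal matrix has the sup norm of its
entries. This gives access to the continuity of `y ↦ f(A y)`. -/
lemma isometricContinuousFunctionalCalculus_matrix :
    IsometricContinuousFunctionalCalculus ℝ (Matrix (Fin d) (Fin d) ℝ) IsSelfAdjoint where
  isometric M hM := by
    have hM' : M.IsHermitian := hM
    refine AddMonoidHomClass.isometry_of_norm _ fun g => ?_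
    rw [hM'.cfcHom_eq_cfcAux, Matrix.IsHermitian.cfcAux_apply, Unitary.conjStarAlgAut_apply,
      ← Unitary.coe_star, CStarRing.norm_mul_coe_unitary, CStarRing.norm_coe_unitary_mul,
      l2_opNorm_diagonal]
    refine le_antisymm ((pi_norm_le_iff_of_nonneg (norm_nonneg _)).2 fun j => ?_)
      ((ContinuousMap.norm_le _ (norm_nonneg _)).2 ?_)
    · simpa using! g.norm_coe_le_norm _
    · rintro ⟨t, ht⟩
      obtain ⟨j, rfl⟩ := hM'.spectrum_real_eq_range_eigenvalues ▸ ht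
      exact norm_le_pi_norm (RCLike.ofReal ∘ g ∘ fun i ↦
        ⟨hM'.eigenvalues i, hM'.eigenvalues_mem_spectrum_real i⟩ : Fin d → ℝ) j

lemma continuousAt_cfc_matrix {X : Type*} [TopologicalSpace X]
    {A : X → Matrix (Fin d) (Fin d) ℝ} {x : X} {s : Set ℝ} (hs : IsCompact s) {f : ℝ → ℝ}
    (hf : ContinuousOn f s) (hA : ContinuousAt A x)
    (hspec : ∀ᶠ y in 𝓝 x, spectrum ℝ (A y) ⊆ s) (hherm : ∀ᶠ y in 𝓝 x, (A y).IsHermitian) :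
    ContinuousAt (fun y => cfc f (A y)) x :=
  haveI := isometricContinuousFunctionalCalculus_matrix (d := d)
  ContinuousAt.cfc hs f hA hspec hherm hf

lemma eventually_spectrum_subset_Icc {X : Type*} [TopologicalSpace X]
    {A : X → Matrix (Fin d) (Fin d) ℝ} {x : X} (hA : ContinuousAt A x) (hx : (A x).PosDef) :
    ∃ a b : ℝ, 0 < a ∧ (∀ j, hx.1.eigenvalues j ∈ Set.Ioo a b) ∧
      ∀ᶠ y in 𝓝 x, spectrum ℝ (A y) ⊆ Set.Icc a b := by
  obtain ⟨a, ha, haj⟩ : ∃ a > 0, ∀ j, a < hx.1.eigenvalues j := by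
    have : ∀ᶠ a in 𝓝[>] (0 : ℝ), ∀ j, a < hx.1.eigenvalues j :=
      eventually_all.2 fun j => nhdsWithin_le_nhds (gt_mem_nhds (hx.eigenvalues_pos j))
    obtain ⟨a, h1, h2⟩ := (this.and self_mem_nhdsWithin).exists
    exact ⟨a, h2, h1⟩
  obtain ⟨b, hbj⟩ : ∃ b, ∀ j, hx.1.eigenvalues j < b :=
    (eventually_all.2 fun j => eventually_gt_atTop (hx.1.eigenvalues j)).exists
  refine ⟨a, b, ha, fun j => ⟨haj j, hbj j⟩, ?_⟩
  have h : Set.Ioo a b ∈ nhdsSet (spectrum ℝ (A x)) := by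
    refine isOpen_Ioo.mem_nhdsSet.2 ?_
    rw [hx.1.spectrum_real_eq_range_eigenvalues]
    rintro _ ⟨j, rfl⟩
    exact ⟨haj j, hbj j⟩
  filter_upwards [hA.eventually (upperHemicontinuous_spectrum ℝ _ (A x) _ h)] with y hy
  exact (subset_of_mem_nhdsSet hy).trans Set.Ioo_subset_Icc_self

lemma star_eigenvectorUnitary_mul_cfc {M : Matrix (Fin d) (Fin d) ℝ} (hM : M.IsHermitian)
    (f : ℝ → ℝ) (j k : Fin d) :
    (star (hM.eigenvectorUnitary : Matrix (Fin d) (Fin d) ℝ) * cfc f M) j k =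
      f (hM.eigenvalues j) * star (hM.eigenvectorUnitary : Matrix (Fin d) (Fin d) ℝ) j k := by
  rw [hM.cfc_eq_mul_diagonal_mul, ← mul_assoc, ← mul_assoc, Unitary.coe_star_mul_self, one_mul,
    diagonal_mul]

lemma cfc_mul_eigenvectorUnitary {M : Matrix (Fin d) (Fin d) ℝ} (hM : M.IsHermitian)
    (f : ℝ → ℝ) (j k : Fin d) :
    (cfc f M * (hM.eigenvectorUnitary : Matrix (Fin d) (Fin d) ℝ)) j k =
      (hM.eigenvectorUnitary : Matrix (Fin d) (Fin d) ℝ) j k * f (hM.eigenvalues k) := by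
  rw [hM.cfc_eq_mul_diagonal_mul, mul_assoc, Unitary.coe_star_mul_self, mul_one,
    mul_diagonal]

/-- The rows of `f(M) - f(N)` in an eigenbasis of `M` factor through those of `M - N`. -/
lemma star_eigenvectorUnitary_mul_cfc_sub_cfc {M N : Matrix (Fin d) (Fin d) ℝ}
    (hM : M.IsHermitian) (hN : N.IsHermitian) (f : ℝ → ℝ) (j k : Fin d) :
    (star (hM.eigenvectorUnitary : Matrix (Fin d) (Fin d) ℝ) * (cfc f M - cfc f N)) j k =
      (star (hM.eigenvectorUnitary : Matrix (Fin d) (Fin d) ℝ) * (M - N) *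
        cfc (dslope f (hM.eigenvalues j)) N) j k := by
  have hcont (g : ℝ → ℝ) : ContinuousOn g (spectrum ℝ N) := N.finite_real_spectrum.continuousOn g
  have hNs : IsSelfAdjoint N := hN
  set U := (hM.eigenvectorUnitary : Matrix (Fin d) (Fin d) ℝ)
  set a := hM.eigenvalues j
  -- The functional calculus at `N` of `f t = f a + (t - a) f[a, t]`.
  have hf : cfc f N = f a • 1 + (N - a • 1) * cfc (dslope f a) N := by
    have h1 : cfc (fun t => t - a) N = N - a • 1 := by
      rw [cfc_sub _ _ N (hcont _) (hcont _), cfc_id' ℝ N, cfc_const a N, Algebra.algebraMap_eq_smul_one]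
    rw [← h1, ← cfc_mul _ _ N (hcont _) (hcont _), ← Algebra.algebraMap_eq_smul_one,
      ← cfc_const (f a) N, ← cfc_add N _ _ (hcont _) (hcont _)]
    refine cfc_congr fun t _ => ?_
    have := sub_smul_dslope f a t
    simp only [smul_eq_mul] at this
    rw [this]; ring
  have hrow (k : Fin d) : (star U * M) j k = a * star U j k := by
    have := star_eigenvectorUnitary_mul_cfc hM id j k
    rwa [cfc_id ℝ M (show IsSelfAdjoint M from hM)] at this
  -- Row `j` of `U*` is a left eigenvector of `M`, so in that row `M` acts as the scalar `a`.
  have hlin : (star U * (M - N)) j = - (star U * (N - a • 1)) j := by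
    funext l
    rw [Pi.neg_apply, mul_sub, mul_sub, Matrix.sub_apply, Matrix.sub_apply, hrow]
    simp
  have hrhs : (star U * (M - N) * cfc (dslope f a) N) j k =
      - (star U * (N - a • 1) * cfc (dslope f a) N) j k := by
    rw [mul_apply, hlin, mul_apply, ← Finset.sum_neg_distrib]
    simp
  rw [hrhs, mul_sub, Matrix.sub_apply, star_eigenvectorUnitary_mul_cfc, hf, mul_add,
    Matrix.add_apply, ← mul_assoc]
  simp [a, U]

lemma abs_unitary_apply_le_one (U : unitaryGroup (Fin d) ℝ) (j k : Fin d) :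
    |(U : Matrix (Fin d) (Fin d) ℝ) j k| ≤ 1 :=
  entry_norm_bound_of_unitary U.2 j k

lemma abs_mul_apply_le {M N : Matrix (Fin d) (Fin d) ℝ} {a b : ℝ} (hM : ∀ j k, |M j k| ≤ a)
    (hN : ∀ j k, |N j k| ≤ b) (j k : Fin d) : |(M * N) j k| ≤ d * (a * b) := by
  rw [mul_apply]
  refine (Finset.abs_sum_le_sum_abs _ _).trans ((Finset.sum_le_card_nsmul _ _ (a * b) ?_).trans ?_)
  · intro l _
    rw [abs_mul]
    exact mul_le_mul (hM _ _) (hN _ _) (abs_nonneg _) ((abs_nonneg _).trans (hM j l))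
  · simp

lemma abs_cfc_apply_le {N : Matrix (Fin d) (Fin d) ℝ} (hN : N.IsHermitian) {f : ℝ → ℝ} {C : ℝ}
    (hf : ∀ t ∈ spectrum ℝ N, |f t| ≤ C) (j k : Fin d) : |cfc f N j k| ≤ d * C := by
  rw [hN.cfc_eq_mul_diagonal_mul]
  refine (abs_mul_apply_le (a := C) (b := 1) (fun j k => ?_) (fun j k => ?_) j k).trans (by simp)
  · rw [mul_diagonal, abs_mul]
    have h := hf _ (hN.eigenvalues_mem_spectrum_real k)
    exact (mul_le_mul (abs_unitary_apply_le_one hN.eigenvectorUnitary j k) h (abs_nonneg _)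
      zero_le_one).trans_eq (one_mul C)
  · rw [← Unitary.coe_star]
    exact abs_unitary_apply_le_one _ _ _

lemma abs_dslope_le_of_abs_deriv_le {s : Set ℝ} (hs : Convex ℝ s) {f : ℝ → ℝ} {C : ℝ}
    (hf : ∀ t ∈ s, DifferentiableAt ℝ f t) (hC : ∀ t ∈ s, |deriv f t| ≤ C) {a b : ℝ}
    (ha : a ∈ s) (hb : b ∈ s) : |dslope f a b| ≤ C := by
  rcases eq_or_ne b a with rfl | hne
  · simpa using hC b hb
  · rw [dslope_of_ne _ hne, slope_def_field, abs_div,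
      div_le_iff₀ (abs_pos.2 (sub_ne_zero.2 hne))]
    exact hs.norm_image_sub_le_of_norm_deriv_le hf hC ha hb

/-- The functional calculus of a differentiable function is Lipschitz for the entrywise norm. -/
lemma abs_cfc_sub_cfc_apply_le {M N : Matrix (Fin d) (Fin d) ℝ} (hM : M.IsHermitian)
    (hN : N.IsHermitian) {s : Set ℝ} (hs : Convex ℝ s) (hMs : spectrum ℝ M ⊆ s)
    (hNs : spectrum ℝ N ⊆ s) {f : ℝ → ℝ} {C : ℝ} (hf : ∀ t ∈ s, DifferentiableAt ℝ f t)
    (hC : ∀ t ∈ s, |deriv f t| ≤ C) {ε : ℝ} (hε : ∀ j k, |(M - N) j k| ≤ ε) (j k : Fin d) :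
    |(cfc f M - cfc f N) j k| ≤ d ^ 4 * C * ε := by
  set U := hM.eigenvectorUnitary
  have hU : cfc f M - cfc f N = (U : Matrix (Fin d) (Fin d) ℝ) *
      (star (U : Matrix (Fin d) (Fin d) ℝ) * (cfc f M - cfc f N)) := by
    rw [← mul_assoc, Unitary.mul_star_self_of_mem U.2, one_mul]
  rw [hU]
  -- Three matrix products and the entry bound for the functional calculus contribute one factor `d`
  -- each.
  refine (abs_mul_apply_le (abs_unitary_apply_le_one U)
    (b := d * (d * (1 * ε) * (d * C))) (fun j k => ?_) j k).trans (le_of_eq (by ring))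
  rw [star_eigenvectorUnitary_mul_cfc_sub_cfc hM hN]
  exact abs_mul_apply_le (M := star (U : Matrix (Fin d) (Fin d) ℝ) * (M - N))
    (abs_mul_apply_le (fun j k => abs_unitary_apply_le_one (star U) j k) hε)
    (abs_cfc_apply_le hN fun t ht => abs_dslope_le_of_abs_deriv_le hs hf hC
      (hMs (hM.eigenvalues_mem_spectrum_real _)) (hNs ht)) j k

end MatrixFunctionalCalculus

/-! ### Derivatives of matrix functions. -/

section MatrixCalculus

open Matrix Filter Topology

variable {n d : ℕ}

/-- The first factor vanishes at `x`, so continuity of `m` suffices: replacing `m y` by `m x` costs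
`O(|y - x|) · o(1)`. -/
lemma HasFDerivAt.sub_self_mul_continuousAt {E : Type*} [NormedAddCommGroup E] [NormedSpace ℝ E]
    {c m : E → ℝ} {c' : E →L[ℝ] ℝ} {x : E} (hc : HasFDerivAt c c' x) (hm : ContinuousAt m x) :
    HasFDerivAt (fun y => (c y - c x) * m y) (m x • c') x := by
  have h1 : HasFDerivAt (fun y => (c y - c x) * m x) (m x • c') x :=
    (hc.sub_const (c x)).mul_const (m x)
  have h2 : HasFDerivAt (fun y => (c y - c x) * (m y - m x)) (0 : E →L[ℝ] ℝ) x := by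
    refine HasFDerivAt.of_isLittleO ?_
    have hm0 : (fun y => m y - m x) =o[𝓝 x] (fun _ => (1 : ℝ)) := by
      rw [Asymptotics.isLittleO_one_iff]
      simpa using! hm.tendsto.sub_const (m x)
    simpa using (hc.isBigO_sub.norm_right.mul_isLittleO hm0).norm_right
  refine ((h1.add h2).congr_fderiv (add_zero _)).congr_of_eventuallyEq (.of_forall fun y => ?_)
  simp only [Pi.add_apply]
  ring

lemma partialD_apply {F : EuclideanSpace ℝ (Fin n) → Matrix (Fin d) (Fin d) ℝ}
    {x : EuclideanSpace ℝ (Fin n)} (hF : MatDifferentiableAt F x) (i : Fin n) (j k : Fin d) :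
    partialD i F x j k = fderiv ℝ (fun y => F y j k) x (EuclideanSpace.single i 1) :=
  (hF j k).lineDeriv_eq_fderiv

lemma MatDifferentiableAt.const_mul {F : EuclideanSpace ℝ (Fin n) → Matrix (Fin d) (Fin d) ℝ}
    {x : EuclideanSpace ℝ (Fin n)} (hF : MatDifferentiableAt F x) (P : Matrix (Fin d) (Fin d) ℝ) :
    MatDifferentiableAt (fun y => P * F y) x := fun j k => by
  simp only [mul_apply]
  exact DifferentiableAt.fun_sum fun l _ => (hF l k).const_mul _

lemma partialD_const_mul {F : EuclideanSpace ℝ (Fin n) → Matrix (Fin d) (Fin d) ℝ}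
    {x : EuclideanSpace ℝ (Fin n)} (hF : MatDifferentiableAt F x) (P : Matrix (Fin d) (Fin d) ℝ)
    (i : Fin n) : partialD i (fun y => P * F y) x = P * partialD i F x := by
  ext j k
  rw [partialD_apply (hF.const_mul P), mul_apply]
  simp only [mul_apply, partialD_apply hF]
  rw [fderiv_fun_sum fun l _ => (hF l k).const_mul _]
  simp [fderiv_const_mul (hF _ k)]

variable {A : EuclideanSpace ℝ (Fin n) → Matrix (Fin d) (Fin d) ℝ} {x : EuclideanSpace ℝ (Fin n)}

lemma MatDifferentiableAt.continuousAt (hA : MatDifferentiableAt A x) : ContinuousAt A x :=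
  continuousAt_pi.2 fun j => continuousAt_pi.2 fun k => (hA j k).continuousAt

/-- In the factorisation through `A x - A y`, the divided-difference factor is merely continuous in
`y`, which is enough because the other factor vanishes at `x`. -/
lemma hasFDerivAt_star_eigenvectorUnitary_mul_cfc (hA : MatDifferentiableAt A x)
    (hpos : ∀ᶠ y in 𝓝 x, (A y).PosDef) (hx : (A x).IsHermitian) {f : ℝ → ℝ}
    (hf : DifferentiableOn ℝ f (Set.Ioi 0)) (j k : Fin d) :
    HasFDerivAt (fun y => (star (hx.eigenvectorUnitary : Matrix (Fin d) (Fin d) ℝ) *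
        cfc f (A y)) j k)
      (∑ l, cfc (dslope f (hx.eigenvalues j)) (A x) l k •
        fderiv ℝ (fun y => (star (hx.eigenvectorUnitary : Matrix (Fin d) (Fin d) ℝ) * A y) j l) x)
      x := by
  set U := (hx.eigenvectorUnitary : Matrix (Fin d) (Fin d) ℝ)
  obtain ⟨a, b, ha, hab, hspec⟩ := eventually_spectrum_subset_Icc hA.continuousAt hpos.self_of_nhds
  have hIcc : Set.Icc a b ⊆ Set.Ioi 0 := fun t ht => ha.trans_le ht.1
  have hdiff (t : ℝ) (ht : t ∈ Set.Icc a b) : DifferentiableAt ℝ f t :=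
    (hf t (hIcc ht)).differentiableAt (Ioi_mem_nhds (hIcc ht))
  -- Continuity of the slope at its base point is differentiability of `f` there; the base point
  -- must be interior to the interval.
  have hslope : ContinuousOn (dslope f (hx.eigenvalues j)) (Set.Icc a b) :=
    (continuousOn_dslope (Icc_mem_nhds (hab j).1 (hab j).2)).2
      ⟨hf.continuousOn.mono hIcc, hdiff _ (Set.Ioo_subset_Icc_self (hab j))⟩
  have hcfc := continuousAt_cfc_matrix isCompact_Icc hslope hA.continuousAt hspec
    (hpos.mono fun y hy => hy.1)
  have hsum := HasFDerivAt.fun_sum (u := Finset.univ) fun l _ =>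
    (hA.const_mul (star U) j l).hasFDerivAt.sub_self_mul_continuousAt
      (m := fun y => cfc (dslope f (hx.eigenvalues j)) (A y) l k)
      (continuousAt_pi.1 (continuousAt_pi.1 hcfc l) k)
  refine (hsum.add_const ((star U * cfc f (A x)) j k)).congr_of_eventuallyEq ?_
  filter_upwards [hpos] with y hy
  have h := star_eigenvectorUnitary_mul_cfc_sub_cfc hx hy.1 f j k
  rw [mul_sub, Matrix.sub_apply, mul_apply (M := star U * _), mul_sub] at h
  simp only [Matrix.sub_apply] at h
  rw [← sub_eq_iff_eq_add, ← neg_sub, h, ← Finset.sum_neg_distrib]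
  exact Finset.sum_congr rfl fun l _ => by ring

lemma MatDifferentiableAt.cfc (hA : MatDifferentiableAt A x)
    (hpos : ∀ᶠ y in 𝓝 x, (A y).PosDef) {f : ℝ → ℝ}
    (hf : DifferentiableOn ℝ f (Set.Ioi 0)) : MatDifferentiableAt (fun y => cfc f (A y)) x := by
  have hx := hpos.self_of_nhds.1
  have hG : MatDifferentiableAt
      (fun y => star (hx.eigenvectorUnitary : Matrix (Fin d) (Fin d) ℝ) * _root_.cfc f (A y)) x :=
    fun j k => (hasFDerivAt_star_eigenvectorUnitary_mul_cfc hA hpos hx hf j k).differentiableAt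
  simpa [← mul_assoc, Unitary.mul_star_self_of_mem hx.eigenvectorUnitary.2] using
    hG.const_mul (hx.eigenvectorUnitary : Matrix (Fin d) (Fin d) ℝ)

/-- The Daleckii-Krein formula. -/
lemma star_mul_partialD_cfc_mul_apply (hA : MatDifferentiableAt A x)
    (hpos : ∀ᶠ y in 𝓝 x, (A y).PosDef) (hx : (A x).IsHermitian) {f : ℝ → ℝ}
    (hf : DifferentiableOn ℝ f (Set.Ioi 0)) (i : Fin n) (j k : Fin d) :
    (star (hx.eigenvectorUnitary : Matrix (Fin d) (Fin d) ℝ) *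
        partialD i (fun y => cfc f (A y)) x *
        (hx.eigenvectorUnitary : Matrix (Fin d) (Fin d) ℝ)) j k =
      dslope f (hx.eigenvalues j) (hx.eigenvalues k) *
        (star (hx.eigenvectorUnitary : Matrix (Fin d) (Fin d) ℝ) *
          partialD i A x * (hx.eigenvectorUnitary : Matrix (Fin d) (Fin d) ℝ)) j k := by
  set U := (hx.eigenvectorUnitary : Matrix (Fin d) (Fin d) ℝ)
  have hF := hA.cfc hpos hf
  have hrow (k : Fin d) : (star U * partialD i (fun y => cfc f (A y)) x) j k =
      (star U * partialD i A x * cfc (dslope f (hx.eigenvalues j)) (A x)) j k := by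
    rw [← partialD_const_mul hF, ← partialD_const_mul hA, partialD_apply (hF.const_mul _),
      (hasFDerivAt_star_eigenvectorUnitary_mul_cfc hA hpos hx hf j k).fderiv, mul_apply]
    simp only [partialD_apply (hA.const_mul _)]
    simp [U, mul_comm]
  -- Multiplying by `U` on the right turns the divided-difference matrix into the scalar `f[a_j,
  -- a_k]` in column `k`.
  calc _ = (star U * partialD i A x * cfc (dslope f (hx.eigenvalues j)) (A x) * U) j k := by
        rw [mul_apply, mul_apply]
        exact Finset.sum_congr rfl fun l _ => by rw [hrow]
    _ = _ := by
        rw [mul_assoc, mul_apply, mul_apply, Finset.mul_sum]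
        exact Finset.sum_congr rfl fun l _ => by rw [cfc_mul_eigenvectorUnitary]; ring

end MatrixCalculus

/-! ### Local Lipschitz continuity and almost everywhere differentiability. -/

section LocallyLipschitz

open Matrix Filter Topology

variable {n d : ℕ} {V : Set (EuclideanSpace ℝ (Fin n))}

/-- Rademacher's theorem for locally Lipschitz functions on an open set. -/
lemma LocallyLipschitzOn.ae_differentiableAt {E : Type*} [NormedAddCommGroup E] [NormedSpace ℝ E]
    [FiniteDimensional ℝ E] [MeasurableSpace E] [BorelSpace E] {μ : Measure E}
    [μ.IsAddHaarMeasure] {W : Set E} {f : E → ℝ} (hf : LocallyLipschitzOn W f) (hW : IsOpen W) :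
    ∀ᵐ x ∂(μ.restrict W), DifferentiableAt ℝ f x := by
  rw [ae_restrict_iff' hW.measurableSet]
  have := FiniteDimensional.proper_real E
  refine measure_null_of_locally_null _ fun x hx => ?_
  simp only [Set.mem_compl_iff, Set.mem_ofPred_eq, Classical.not_imp] at hx
  obtain ⟨K, t, ht, hK⟩ := hf hx.1
  rw [hW.nhdsWithin_eq hx.1] at ht
  refine ⟨_, inter_mem_nhdsWithin _ (interior_mem_nhds.2 ht), ?_⟩
  refine measure_mono_null ?_ hK.ae_differentiableWithinAt_of_mem
  rintro y ⟨hy, hyt⟩ h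
  exact hy fun _ => (h (interior_subset hyt)).differentiableAt (mem_interior_iff_mem_nhds.1 hyt)

lemma LocLipOn.ae_matDifferentiableAt {A : EuclideanSpace ℝ (Fin n) → Matrix (Fin d) (Fin d) ℝ}
    (hA : LocLipOn V A) (hV : IsOpen V) :
    ∀ᵐ x ∂(volume.restrict V), MatDifferentiableAt A x :=
  ae_all_iff.2 fun j => ae_all_iff.2 fun k => (hA j k).ae_differentiableAt hV

lemma LocLipOn.exists_dist_le {A : EuclideanSpace ℝ (Fin n) → Matrix (Fin d) (Fin d) ℝ}
    (hA : LocLipOn V A) {x : EuclideanSpace ℝ (Fin n)} (hx : x ∈ V) :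
    ∃ K : NNReal, ∃ t ∈ 𝓝[V] x, ∀ y ∈ t, ∀ z ∈ t, ∀ j k, |(A y - A z) j k| ≤ K * dist y z := by
  choose K t ht hK using fun j k => hA j k hx
  refine ⟨∑ j, ∑ k, K j k, ⋂ j, ⋂ k, t j k,
    iInter_mem.2 fun j => iInter_mem.2 fun k => ht j k, fun y hy z hz j k => ?_⟩
  simp only [Set.mem_iInter] at hy hz
  refine ((hK j k).dist_le_mul y (hy j k) z (hz j k)).trans ?_
  gcongr
  exact (Finset.single_le_sum (f := fun k => K j k) (fun _ _ => zero_le) (Finset.mem_univ k)).trans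
    (Finset.single_le_sum (f := fun j => ∑ k, K j k) (fun _ _ => zero_le) (Finset.mem_univ j))

/-- Near a point all spectra lie in one compact interval of positive numbers, on which `f'` is
bounded. -/
lemma LocLipOn.cfc {A : EuclideanSpace ℝ (Fin n) → Matrix (Fin d) (Fin d) ℝ}
    (hA : LocLipOn V A) (hV : IsOpen V) (hpos : ∀ x ∈ V, (A x).PosDef) {f : ℝ → ℝ}
    (hf : ContDiffOn ℝ 1 f (Set.Ioi 0)) : LocLipOn V (fun x => cfc f (A x)) := by
  intro j k x hx
  obtain ⟨K, t, ht, hK⟩ := hA.exists_dist_le hx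
  have hcont : ContinuousAt A x := continuousAt_pi.2 fun j => continuousAt_pi.2 fun k =>
    ((hA j k).continuousOn x hx).continuousAt (hV.mem_nhds hx)
  obtain ⟨a, b, ha, -, hspec⟩ := eventually_spectrum_subset_Icc hcont (hpos x hx)
  have hIcc : Set.Icc a b ⊆ Set.Ioi 0 := fun t ht => ha.trans_le ht.1
  have hdiff (t : ℝ) (ht : t ∈ Set.Icc a b) : DifferentiableAt ℝ f t :=
    (hf.differentiableOn one_ne_zero t (hIcc ht)).differentiableAt (Ioi_mem_nhds (hIcc ht))
  obtain ⟨C, hC⟩ := isCompact_Icc.exists_bound_of_continuousOn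
    ((hf.continuousOn_deriv_of_isOpen isOpen_Ioi le_rfl).mono hIcc)
  have hC' (t : ℝ) (ht : t ∈ Set.Icc a b) : |deriv f t| ≤ (Real.toNNReal C : ℝ) :=
    (hC t ht).trans (Real.le_coe_toNNReal C)
  refine ⟨d ^ 4 * Real.toNNReal C * K, t ∩ ({y | spectrum ℝ (A y) ⊆ Set.Icc a b} ∩ V),
    inter_mem ht (inter_mem (nhdsWithin_le_nhds hspec) self_mem_nhdsWithin), ?_⟩
  refine LipschitzOnWith.of_dist_le_mul fun y hy z hz => ?_
  have := abs_cfc_sub_cfc_apply_le (hpos y hy.2.2).1 (hpos z hz.2.2).1 (convex_Icc a b) hy.2.1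
    hz.2.1 hdiff hC' (hK y hy.1 z hz.1) j k
  rw [Real.dist_eq]
  refine this.trans_eq ?_
  push_cast
  ring

end LocallyLipschitz

/-! ### Log-convexity of the divided differences in the exponent. -/

section PowerMean

/-- The mean of `v ↦ v ^ (r - 1)` over the segment from `a` to `b`: the divided difference at
`a`, `b` of `t ↦ r⁻¹ t ^ r`, respectively of `log` for `r = 0`. -/
noncomputable def segmentPowMean (r a b : ℝ) : ℝ :=
  ∫ t in (0 : ℝ)..1, (a + t * (b - a)) ^ (r - 1)

variable {a b : ℝ}

lemma segment_pos (ha : 0 < a) (hb : 0 < b) {t : ℝ} (ht : t ∈ Set.Icc (0 : ℝ) 1) :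
    0 < a + t * (b - a) := by
  rcases ht.1.eq_or_lt with rfl | h
  · simpa
  · nlinarith [mul_pos h hb, mul_nonneg (sub_nonneg.2 ht.2) ha.le]

lemma continuousOn_segment_rpow (ha : 0 < a) (hb : 0 < b) (r : ℝ) :
    ContinuousOn (fun t : ℝ => (a + t * (b - a)) ^ r) (Set.Icc 0 1) :=
  ContinuousOn.rpow_const (by fun_prop) fun _ ht => .inl (segment_pos ha hb ht).ne'

lemma intervalIntegrable_segment_rpow (ha : 0 < a) (hb : 0 < b) (r : ℝ) :
    IntervalIntegrable (fun t : ℝ => (a + t * (b - a)) ^ r) volume 0 1 :=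
  (continuousOn_segment_rpow ha hb r).intervalIntegrable_of_Icc zero_le_one

lemma segmentPowMean_self (r a : ℝ) : segmentPowMean r a a = a ^ (r - 1) := by
  simp [segmentPowMean]

lemma segmentPowMean_pos (ha : 0 < a) (hb : 0 < b) (r : ℝ) : 0 < segmentPowMean r a b :=
  intervalIntegral.intervalIntegral_pos_of_pos_on (intervalIntegrable_segment_rpow ha hb _)
    (fun _ ht => Real.rpow_pos_of_pos (segment_pos ha hb (Set.Ioo_subset_Icc_self ht)) _)
    zero_lt_one

/-- The fundamental theorem of calculus along the segment. The constant is `c = r` for `t ^ r` and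
`c = 1` for `log`. -/
lemma dslope_eq_mul_segmentPowMean (ha : 0 < a) (hb : 0 < b) {f : ℝ → ℝ} {c r : ℝ}
    (hf : ∀ t, 0 < t → HasDerivAt f (c * t ^ (r - 1)) t) :
    dslope f a b = c * segmentPowMean r a b := by
  rcases eq_or_ne b a with rfl | hne
  · rw [dslope_same, (hf b hb).deriv, segmentPowMean_self]
  · have h := intervalIntegral.integral_unitInterval_deriv_eq_sub (f := f) (f' := fun t => c * t ^ (r - 1))
      (z₀ := a) (z₁ := b - a) (continuousOn_const.mul (continuousOn_segment_rpow ha hb (r - 1)))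
      fun t ht => hf _ (segment_pos ha hb ht)
    simp only [smul_eq_mul, intervalIntegral.integral_const_mul, add_sub_cancel] at h
    rw [dslope_of_ne _ hne, slope_def_field, ← h, segmentPowMean,
      mul_div_cancel_left₀ _ (sub_ne_zero.2 hne)]

lemma segmentPowMean_convexComb_le (ha : 0 < a) (hb : 0 < b) {s : ℝ} (hs₀ : 0 ≤ s) (hs₁ : s ≤ 1)
    (x y : ℝ) : segmentPowMean (s * x + (1 - s) * y) a b ≤
      segmentPowMean x a b ^ s * segmentPowMean y a b ^ (1 - s) := by
  set X := segmentPowMean x a b with hX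
  set Y := segmentPowMean y a b with hY
  have hX0 : 0 < X := segmentPowMean_pos ha hb x
  have hY0 : 0 < Y := segmentPowMean_pos ha hb y
  have hint (r c : ℝ) := (intervalIntegrable_segment_rpow ha hb r).const_mul c
  -- Hölder by hand: weighted AM-GM applied to the two integrands divided by their integrals `X` and
  -- `Y`; integrating leaves the total `s + (1 - s) = 1`.
  calc segmentPowMean (s * x + (1 - s) * y) a b
    _ ≤ ∫ t in (0 : ℝ)..1, (X ^ s * Y ^ (1 - s) * (s / X) * (a + t * (b - a)) ^ (x - 1) +
          X ^ s * Y ^ (1 - s) * ((1 - s) / Y) * (a + t * (b - a)) ^ (y - 1)) := by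
        refine intervalIntegral.integral_mono_on zero_le_one
          (intervalIntegrable_segment_rpow ha hb _) ((hint _ _).add (hint _ _)) fun t ht => ?_
        have hv := segment_pos ha hb ht
        set v := a + t * (b - a)
        have hx := Real.rpow_pos_of_pos hv (x - 1)
        have hy := Real.rpow_pos_of_pos hv (y - 1)
        have key := Real.geom_mean_le_arith_mean2_weighted hs₀ (sub_nonneg.2 hs₁)
          (div_pos hx hX0).le (div_pos hy hY0).le (by ring)
        rw [Real.div_rpow hx.le hX0.le, Real.div_rpow hy.le hY0.le, ← Real.rpow_mul hv.le,
          ← Real.rpow_mul hv.le] at key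
        have hXs := Real.rpow_pos_of_pos hX0 s
        have hYs := Real.rpow_pos_of_pos hY0 (1 - s)
        calc v ^ (s * x + (1 - s) * y - 1)
          _ = X ^ s * Y ^ (1 - s) *
              (v ^ ((x - 1) * s) / X ^ s * (v ^ ((y - 1) * (1 - s)) / Y ^ (1 - s))) := by
              have : v ^ (s * x + (1 - s) * y - 1) =
                  v ^ ((x - 1) * s) * v ^ ((y - 1) * (1 - s)) := by
                rw [← Real.rpow_add hv]; ring_nf
              rw [this]
              field_simp
          _ ≤ X ^ s * Y ^ (1 - s) * _ := mul_le_mul_of_nonneg_left key (mul_pos hXs hYs).le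
          _ = _ := by ring
    _ = X ^ s * Y ^ (1 - s) := by
        rw [intervalIntegral.integral_add (hint _ _) (hint _ _),
          intervalIntegral.integral_const_mul, intervalIntegral.integral_const_mul,
          ← segmentPowMean, ← segmentPowMean, ← hX, ← hY]
        field_simp
        ring

lemma segmentPowMean_midpoint_sq_le (ha : 0 < a) (hb : 0 < b) (x y : ℝ) :
    segmentPowMean ((x + y) / 2) a b ^ 2 ≤ segmentPowMean x a b * segmentPowMean y a b := by
  have h := segmentPowMean_convexComb_le ha hb (s := 1 / 2) (by norm_num) (by norm_num) x y
  have hX := (segmentPowMean_pos ha hb x).le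
  have hY := (segmentPowMean_pos ha hb y).le
  rw [show (1 : ℝ) / 2 * x + (1 - 1 / 2) * y = (x + y) / 2 by ring,
    show (1 : ℝ) - 1 / 2 = 1 / 2 by norm_num, ← Real.mul_rpow hX hY, ← Real.sqrt_eq_rpow] at h
  calc _ ≤ √(segmentPowMean x a b * segmentPowMean y a b) ^ 2 :=
        pow_le_pow_left₀ (segmentPowMean_pos ha hb _).le h 2
    _ = _ := Real.sq_sqrt (mul_nonneg hX hY)

lemma segmentPowMean_sq_le (ha : 0 < a) (hb : 0 < b) {s : ℝ} (hs₀ : 0 ≤ s) (hs₁ : s ≤ 1)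
    (α β γ δ : ℝ) :
    segmentPowMean (s * ((α + β) / 2) + (1 - s) * ((γ + δ) / 2)) a b ^ 2 ≤
      (segmentPowMean α a b * segmentPowMean β a b) ^ s *
        (segmentPowMean γ a b * segmentPowMean δ a b) ^ (1 - s) := by
  have h (r : ℝ) := (segmentPowMean_pos ha hb r).le
  refine (pow_le_pow_left₀ (h _) (segmentPowMean_convexComb_le ha hb hs₀ hs₁ _ _) 2).trans ?_
  rw [mul_pow, ← Real.rpow_mul_natCast (h _), ← Real.rpow_mul_natCast (h _), mul_comm s,
    mul_comm (1 - s), Real.rpow_natCast_mul (h _), Real.rpow_natCast_mul (h _)]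
  exact mul_le_mul
    (Real.rpow_le_rpow (sq_nonneg _) (segmentPowMean_midpoint_sq_le ha hb α β) hs₀)
    (Real.rpow_le_rpow (sq_nonneg _) (segmentPowMean_midpoint_sq_le ha hb γ δ) (sub_nonneg.2 hs₁))
    (Real.rpow_nonneg (sq_nonneg _) _) (Real.rpow_nonneg (mul_nonneg (h _) (h _)) _)

end PowerMean

/-- Hölder with exponents `1 / s` and `1 / (1 - s)`, the weight being split as `w ^ s * w ^ (1 -
s)`. -/
lemma sum_rpow_mul_rpow_mul_le {ι : Type*} (S : Finset ι) {w X Y : ι → ℝ} (hw : ∀ i, 0 ≤ w i)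
    (hX : ∀ i, 0 ≤ X i) (hY : ∀ i, 0 ≤ Y i) {s : ℝ} (hs₀ : 0 ≤ s) (hs₁ : s ≤ 1) :
    ∑ i ∈ S, X i ^ s * Y i ^ (1 - s) * w i ≤
      (∑ i ∈ S, X i * w i) ^ s * (∑ i ∈ S, Y i * w i) ^ (1 - s) := by
  rcases hs₀.eq_or_lt with rfl | hs₀
  · simp
  rcases hs₁.eq_or_lt with rfl | hs₁
  · simp
  have hs₁' : 0 < 1 - s := sub_pos.2 hs₁
  have hXw (i : ι) : 0 ≤ X i * w i := mul_nonneg (hX i) (hw i)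
  have hYw (i : ι) : 0 ≤ Y i * w i := mul_nonneg (hY i) (hw i)
  have h := Real.inner_le_Lp_mul_Lq S (fun i => (X i * w i) ^ s) (fun i => (Y i * w i) ^ (1 - s))
    (p := s⁻¹) (q := (1 - s)⁻¹) (Real.holderConjugate_iff.2 ⟨(one_lt_inv₀ hs₀).2 hs₁, by simp⟩)
  have hcancel {t z : ℝ} (ht : 0 < t) (hz : 0 ≤ z) : |z ^ t| ^ t⁻¹ = z := by
    rw [abs_of_nonneg (Real.rpow_nonneg hz _), Real.rpow_rpow_inv hz ht.ne']
  simp only [hcancel hs₀ (hXw _), hcancel hs₁' (hYw _), one_div, inv_inv] at h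
  refine (Finset.sum_le_sum fun i _ => le_of_eq ?_).trans h
  rw [Real.mul_rpow (hX i) (hw i), Real.mul_rpow (hY i) (hw i)]
  have : w i = w i ^ s * w i ^ (1 - s) := by
    rw [← Real.rpow_add_of_nonneg (hw i) hs₀.le hs₁'.le]; simp
  conv_lhs => rw [this]
  ring

/-! ### The tensors `𝒟^r A` in an eigenbasis, and the inequality. -/

section PowerDerivative

open Matrix Filter Topology

variable {n d : ℕ}

lemma innerMat_eq_trace (X Y : Matrix (Fin d) (Fin d) ℝ) : innerMat X Y = (Xᵀ * Y).trace := by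
  simp only [innerMat, trace, diag_apply, mul_apply, transpose_apply]
  exact Finset.sum_comm

lemma innerMat_star_mul_mul (U : unitaryGroup (Fin d) ℝ) (X Y : Matrix (Fin d) (Fin d) ℝ) :
    innerMat (star (U : Matrix (Fin d) (Fin d) ℝ) * X * (U : Matrix (Fin d) (Fin d) ℝ))
      (star (U : Matrix (Fin d) (Fin d) ℝ) * Y * (U : Matrix (Fin d) (Fin d) ℝ)) =
      innerMat X Y := by
  have hU : (U : Matrix (Fin d) (Fin d) ℝ) * (U : Matrix (Fin d) (Fin d) ℝ)ᵀ = 1 :=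
    Unitary.mul_star_self_of_mem U.2
  have hs : star (U : Matrix (Fin d) (Fin d) ℝ) = (U : Matrix (Fin d) (Fin d) ℝ)ᵀ := rfl
  set W := (U : Matrix (Fin d) (Fin d) ℝ)
  rw [innerMat_eq_trace, innerMat_eq_trace, hs, transpose_mul, transpose_mul, transpose_transpose]
  calc _ = (Wᵀ * (Xᵀ * (W * Wᵀ) * Y * W)).trace := by simp only [mul_assoc]
    _ = (Xᵀ * (W * Wᵀ) * Y * (W * Wᵀ)).trace := by rw [trace_mul_comm]; simp only [mul_assoc]
    _ = _ := by rw [hU, mul_one, mul_one]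

lemma innerTensor_eq_sum_innerMat (X Y : Fin n → Matrix (Fin d) (Fin d) ℝ) :
    innerTensor X Y = ∑ i, innerMat (X i) (Y i) := rfl

variable {A : EuclideanSpace ℝ (Fin n) → Matrix (Fin d) (Fin d) ℝ} {x : EuclideanSpace ℝ (Fin n)}

lemma differentiableOn_rpow_Ioi (r : ℝ) :
    DifferentiableOn ℝ (fun t : ℝ => t ^ r) (Set.Ioi 0) := fun _ ht =>
  (Real.differentiableAt_rpow_const_of_ne r (ne_of_gt ht)).differentiableWithinAt

lemma star_mul_powD_mul_apply (hA : MatDifferentiableAt A x) (hpos : ∀ᶠ y in 𝓝 x, (A y).PosDef)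
    (hx : (A x).PosDef) (r : ℝ) (i : Fin n) (j k : Fin d) :
    (star (hx.1.eigenvectorUnitary : Matrix (Fin d) (Fin d) ℝ) * powD r A x i *
        (hx.1.eigenvectorUnitary : Matrix (Fin d) (Fin d) ℝ)) j k =
      segmentPowMean r (hx.1.eigenvalues j) (hx.1.eigenvalues k) *
        (star (hx.1.eigenvectorUnitary : Matrix (Fin d) (Fin d) ℝ) * partialD i A x *
          (hx.1.eigenvectorUnitary : Matrix (Fin d) (Fin d) ℝ)) j k := by
  have hj := hx.eigenvalues_pos j
  have hk := hx.eigenvalues_pos k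
  rcases eq_or_ne r 0 with rfl | hr
  · have hlog : DifferentiableOn ℝ Real.log (Set.Ioi 0) := fun _ ht =>
      (Real.differentiableAt_log (ne_of_gt ht)).differentiableWithinAt
    simp only [powD, if_true, matLog]
    rw [star_mul_partialD_cfc_mul_apply hA hpos hx.1 hlog,
      dslope_eq_mul_segmentPowMean hj hk (c := 1) (r := 0), one_mul]
    intro t ht
    simpa [Real.rpow_neg_one] using Real.hasDerivAt_log ht.ne'
  · simp only [powD, if_neg hr, matPow]
    rw [mul_smul_comm, smul_mul_assoc, Matrix.smul_apply,
      star_mul_partialD_cfc_mul_apply hA hpos hx.1 (differentiableOn_rpow_Ioi r),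
      dslope_eq_mul_segmentPowMean hj hk (c := r) (r := r), smul_eq_mul, mul_assoc,
      inv_mul_cancel_left₀ hr]
    exact fun t ht => Real.hasDerivAt_rpow_const (.inl ht.ne')

lemma star_mul_matPow_mul {M : Matrix (Fin d) (Fin d) ℝ} (hM : M.IsHermitian) (r : ℝ) :
    star (hM.eigenvectorUnitary : Matrix (Fin d) (Fin d) ℝ) * matPow M r *
      (hM.eigenvectorUnitary : Matrix (Fin d) (Fin d) ℝ) =
      diagonal (fun j => hM.eigenvalues j ^ r) := by
  ext j k
  rw [mul_assoc, mul_apply]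
  simp only [matPow, cfc_mul_eigenvectorUnitary, ← mul_assoc]
  rw [← Finset.sum_mul, ← mul_apply, Unitary.star_mul_self_of_mem hM.eigenvectorUnitary.2]
  rcases eq_or_ne j k with rfl | h
  · simp
  · simp [h]

lemma innerMat_diagonal (X : Matrix (Fin d) (Fin d) ℝ) (v : Fin d → ℝ) :
    innerMat X (diagonal v) = ∑ j, X j j * v j := by
  simp [innerMat, diagonal_apply]

/-- In the eigenbasis `A ^ β` is diagonal, and the claim reduces to `a ^ (α - 1) * a ^ β = a ^ (α +
β - 1)`. -/
lemma innerMat_powD_matPow (hA : MatDifferentiableAt A x) (hpos : ∀ᶠ y in 𝓝 x, (A y).PosDef)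
    (α β : ℝ) (i : Fin n) :
    innerMat (powD α A x i) (matPow (A x) β) = innerMat (powD (α + β) A x i) 1 := by
  have hx := hpos.self_of_nhds
  rw [← innerMat_star_mul_mul hx.1.eigenvectorUnitary, star_mul_matPow_mul,
    ← innerMat_star_mul_mul hx.1.eigenvectorUnitary (powD (α + β) A x i) 1, mul_one,
    Unitary.star_mul_self_of_mem hx.1.eigenvectorUnitary.2, ← diagonal_one, innerMat_diagonal,
    innerMat_diagonal]
  refine Finset.sum_congr rfl fun j _ => ?_
  rw [star_mul_powD_mul_apply hA hpos hx, star_mul_powD_mul_apply hA hpos hx,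
    segmentPowMean_self, segmentPowMean_self, mul_one, mul_right_comm,
    ← Real.rpow_add (hx.eigenvalues_pos j)]
  ring_nf

/-- In an eigenbasis the inner products of the tensors `𝒟^r A` are weighted sums with common
nonnegative weights. -/
lemma exists_weight_innerTensor_powD (hA : MatDifferentiableAt A x)
    (hpos : ∀ᶠ y in 𝓝 x, (A y).PosDef) :
    ∃ (a : Fin d → ℝ) (w : Fin n × Fin d × Fin d → ℝ), (∀ j, 0 < a j) ∧ (∀ t, 0 ≤ w t) ∧
      ∀ r s : ℝ, innerTensor (powD r A x) (powD s A x) =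
        ∑ t, segmentPowMean r (a t.2.1) (a t.2.2) * segmentPowMean s (a t.2.1) (a t.2.2) * w t := by
  have hx := hpos.self_of_nhds
  refine ⟨hx.1.eigenvalues, fun t =>
    ((star (hx.1.eigenvectorUnitary : Matrix (Fin d) (Fin d) ℝ) * partialD t.1 A x *
      (hx.1.eigenvectorUnitary : Matrix (Fin d) (Fin d) ℝ)) t.2.1 t.2.2) ^ 2,
    hx.eigenvalues_pos, fun t => sq_nonneg _, fun r s => ?_⟩
  simp only [innerTensor_eq_sum_innerMat, Fintype.sum_prod_type]
  refine Finset.sum_congr rfl fun i _ => ?_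
  rw [← innerMat_star_mul_mul hx.1.eigenvectorUnitary]
  simp only [innerMat, star_mul_powD_mul_apply hA hpos hx]
  exact Finset.sum_congr rfl fun j _ => Finset.sum_congr rfl fun k _ => by ring

lemma innerTensor_powD_nonneg (hA : MatDifferentiableAt A x)
    (hpos : ∀ᶠ y in 𝓝 x, (A y).PosDef) (r s : ℝ) :
    0 ≤ innerTensor (powD r A x) (powD s A x) := by
  obtain ⟨a, w, ha, hw, h⟩ := exists_weight_innerTensor_powD hA hpos
  rw [h]
  exact Finset.sum_nonneg fun t _ => mul_nonneg (mul_nonneg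
    (segmentPowMean_pos (ha _) (ha _) _).le (segmentPowMean_pos (ha _) (ha _) _).le) (hw t)

lemma normTensor_powD_rpow_le (hA : MatDifferentiableAt A x)
    (hpos : ∀ᶠ y in 𝓝 x, (A y).PosDef) {p q : ℝ} (hp : 0 ≤ p) (hq : 0 ≤ q) (α β γ δ : ℝ) :
    normTensor (powD (((α + β) * p + (γ + δ) * q) / (2 * p + 2 * q)) A x) ^ (2 * p + 2 * q) ≤
      innerTensor (powD α A x) (powD β A x) ^ p * innerTensor (powD γ A x) (powD δ A x) ^ q := by
  -- For `p = q = 0` the index is the default value of `0 / 0`, but every power has exponent `0`, so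
  -- both sides are `1`.
  rcases (add_nonneg hp hq).eq_or_lt with hpq | hpq
  · obtain rfl : p = 0 := by linarith
    obtain rfl : q = 0 := by linarith
    simp
  set s := p / (p + q) with hs
  have hs₀ : 0 ≤ s := div_nonneg hp hpq.le
  have hs₁ : s ≤ 1 := (div_le_one hpq).2 (by linarith)
  have hsp : s * (p + q) = p := div_mul_cancel₀ p hpq.ne'
  have hsq : (1 - s) * (p + q) = q := by rw [sub_mul, hsp]; ring
  have hθ : ((α + β) * p + (γ + δ) * q) / (2 * p + 2 * q) =
      s * ((α + β) / 2) + (1 - s) * ((γ + δ) / 2) := by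
    rw [div_eq_iff (by linarith)]
    calc _ = (α + β) * (s * (p + q)) + (γ + δ) * ((1 - s) * (p + q)) := by rw [hsp, hsq]
      _ = _ := by ring
  set θ := ((α + β) * p + (γ + δ) * q) / (2 * p + 2 * q)
  have h₁ := innerTensor_powD_nonneg hA hpos α β
  have h₂ := innerTensor_powD_nonneg hA hpos γ δ
  have hθθ := innerTensor_powD_nonneg hA hpos θ θ
  -- The inequality before raising to the power `p + q`, which turns `s` and `1 - s` into `p` and
  -- `q`.
  have key : innerTensor (powD θ A x) (powD θ A x) ≤
      innerTensor (powD α A x) (powD β A x) ^ s *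
        innerTensor (powD γ A x) (powD δ A x) ^ (1 - s) := by
    obtain ⟨a, w, ha, hw, h⟩ := exists_weight_innerTensor_powD hA hpos
    have hL (r : ℝ) (t : Fin n × Fin d × Fin d) :=
      (segmentPowMean_pos (ha t.2.1) (ha t.2.2) r).le
    rw [h, h, h]
    refine (Finset.sum_le_sum fun t _ => mul_le_mul_of_nonneg_right ?_ (hw t)).trans
      (sum_rpow_mul_rpow_mul_le Finset.univ hw (fun t => mul_nonneg (hL α t) (hL β t))
        (fun t => mul_nonneg (hL γ t) (hL δ t)) hs₀ hs₁)
    rw [← pow_two, hθ]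
    exact segmentPowMean_sq_le (ha _) (ha _) hs₀ hs₁ α β γ δ
  calc _ = innerTensor (powD θ A x) (powD θ A x) ^ (p + q) := by
        rw [normTensor, Real.sqrt_eq_rpow, ← Real.rpow_mul hθθ]
        ring_nf
    _ ≤ (innerTensor (powD α A x) (powD β A x) ^ s *
        innerTensor (powD γ A x) (powD δ A x) ^ (1 - s)) ^ (p + q) :=
        Real.rpow_le_rpow hθθ key hpq.le
    _ = _ := by
        rw [Real.mul_rpow (Real.rpow_nonneg h₁ _) (Real.rpow_nonneg h₂ _), ← Real.rpow_mul h₁,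
          ← Real.rpow_mul h₂, hsp, hsq]

end PowerDerivative


theorem theorem1p1 {n d : ℕ} (V : Set (EuclideanSpace ℝ (Fin n))) (hV : IsOpen V)
    (A : EuclideanSpace ℝ (Fin n) → Matrix (Fin d) (Fin d) ℝ)
    (hLip : LocLipOn V A) (hpos : ∀ x ∈ V, (A x).PosDef)
    (p q : ℝ) (hp : 0 ≤ p) (hq : 0 ≤ q) (α β γ δ : ℝ) :
    -- the derivatives in the claim make sense: powers and logarithm of `A` are again locally
    -- Lipschitz, and classically differentiable almost everywhere
    ((∀ r : ℝ, LocLipOn V (fun x => matPow (A x) r)) ∧ LocLipOn V (fun x => matLog (A x)) ∧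
      (∀ r : ℝ, ∀ᵐ x ∂(volume.restrict V), MatDifferentiableAt (fun y => matPow (A y) r) x) ∧
      (∀ᵐ x ∂(volume.restrict V), MatDifferentiableAt (fun y => matLog (A y)) x)) ∧
    -- the identity
    (∀ᵐ x ∂(volume.restrict V), ∀ i : Fin n,
      innerMat (powD α A x i) (matPow (A x) β) = innerMat (powD (α + β) A x i) 1) ∧
    -- the inequality; the inner products raised to real powers are nonnegative
    (∀ᵐ x ∂(volume.restrict V),
      0 ≤ innerTensor (powD α A x) (powD β A x) ∧
      0 ≤ innerTensor (powD γ A x) (powD δ A x) ∧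
      normTensor (powD (((α + β) * p + (γ + δ) * q) / (2 * p + 2 * q)) A x) ^ (2 * p + 2 * q) ≤
        innerTensor (powD α A x) (powD β A x) ^ p *
          innerTensor (powD γ A x) (powD δ A x) ^ q) := by
  have hpow (r : ℝ) : LocLipOn V (fun x => matPow (A x) r) :=
    hLip.cfc hV hpos fun t ht => (Real.contDiffAt_rpow_const_of_ne (ne_of_gt ht)).contDiffWithinAt
  have hlog : LocLipOn V (fun x => matLog (A x)) :=
    hLip.cfc hV hpos fun t ht => (Real.contDiffAt_log.2 (ne_of_gt ht)).contDiffWithinAt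
  -- One null set, independent of all exponents, serves both the identity and the inequality.
  have hdiff : ∀ᵐ x ∂(volume.restrict V),
      MatDifferentiableAt A x ∧ ∀ᶠ y in nhds x, (A y).PosDef := by
    filter_upwards [hLip.ae_matDifferentiableAt hV, ae_restrict_mem hV.measurableSet] with x hx hxV
    exact ⟨hx, Filter.mem_of_superset (hV.mem_nhds hxV) hpos⟩
  refine ⟨⟨hpow, hlog, fun r => (hpow r).ae_matDifferentiableAt hV,
    hlog.ae_matDifferentiableAt hV⟩, ?_, ?_⟩
  · filter_upwards [hdiff] with x hx i
    exact innerMat_powD_matPow hx.1 hx.2 α β i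
  · filter_upwards [hdiff] with x hx
    exact ⟨innerTensor_powD_nonneg hx.1 hx.2 α β, innerTensor_powD_nonneg hx.1 hx.2 γ δ,
      normTensor_powD_rpow_le hx.1 hx.2 hp hq α β γ δ⟩
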